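/- Let $G$ be a finite group and let $N\unlhd G$ be a normal subgroup. A subgroup $A$ of a group $B$ has a complement in $B$ if there is a subgroup $K\le B$ with $B=AK$ and $A\cap K=1$. (a) Let $\pi$ be a set of primes such that for every $p\in\pi$ there exists a Sylow $p$-subgroup $P$ of $G$ such that $P\cap N$ is abelian and has a complement in $P$. Then there exists a subgroup $H\le G$ such that $G=HN$ and no prime divisor of $|H\cap N|$ lies in $\pi$. (b) (Šemetkov's theorem) Suppose that for every prime divisor $p$ of $|G:N|$, $N$ has an abelian Sylow $p$-subgroup $P$ such that $P$ is contained, and has a complement, in some Sylow $p$-subgroup of $G$. Then $N$ has a complement in $G$. -/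

import Mathlib

open scoped Pointwise

/-- The subgroup `A` of `G` lies in the subgroup `B` and has a complement in `B`: there is a
subgroup `K` of `B` with `A ∩ K = 1` and `B = AK`. -/
def HasComplementIn {G : Type*} [Group G] (A B : Subgroup G) : Prop :=
  A ≤ B ∧ ∃ K : Subgroup B, Subgroup.IsComplement' (A.subgroupOf B) K

/-!
Call a `p`-subgroup `K` of `G` a Sylow lift if it maps isomorphically onto a Sylow `p`-subgroup of
`G / N`. A complement of `P ∩ N` in a Sylow `p`-subgroup `P` of `G` is a Sylow lift, and the
hypothesis of (a) says that for each `p ∈ π` the `p`-subgroups of `N` are abelian and a Sylow lift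
exists. In this form it passes to every subgroup `X` with `XN = G` that contains Sylow lifts for all
`p ∈ π`, so one may descend from `G` through such subgroups.

For a single prime, Gaschütz's theorem (`Subgroup.exists_isComplement'_of_disjoint_of_coprime`) in
the normaliser of a Sylow subgroup of `N` would do. Passing to that subgroup may destroy the Sylow
lifts for the other primes, however, as may the choice of a minimal supplement of `N`. The descent
therefore uses the transfer. If `N` has a nontrivial central `p`-element, the transfer `V` from `N`
to an abelian Sylow `p`-subgroup gives a splitting `N = R ⋊ C` with `R` its kernel, normal in `G`,
and `C ≠ 1` its range, normalised by a given Sylow lift `K`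
(`Subgroup.exists_normal_complement_of_mem_center`). Gaschütz's theorem in `G / R` provides `X < G`
with `XN = G` and `X ∩ N = R`. The index `|G : X| = |C|` is a power of `p`, so `X` contains
conjugates of the Sylow lifts for the primes other than `p`, and `X ∩ CK` is a Sylow lift for `p`
(`Subgroup.exists_supplement_of_mem_center`).

To create central `p`-elements, let by induction on the set of primes `H` be a minimal supplement of
`N` such that `|H ∩ N|` is prime to the elements of `π` other than `p`. By the Frattini argument
`H ∩ N` is nilpotent. If `p` divides its order, let `T` be its Sylow `p`-subgroup, and
replace `G` by `H C_N(T)`. This group contains Sylow lifts for all primes in `π`, and `T` is central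
in its intersection `C_N(T)` with `N` (`Subgroup.exists_lt_supplement_of_dvd_card`). This gives (a);
(b) follows by applying the Schur–Zassenhaus theorem to `H ∩ N` in `H`, where `H` is the subgroup
from (a) for the set of prime divisors of `|G : N|`.
-/

/-! ### The transfer into an abelian subgroup -/

namespace MonoidHom
open Subgroup MulAction
open scoped IsMulCommutative

variable {G : Type*} [Group G] {H : Subgroup G} [H.FiniteIndex]

/-- Up to conjugation of its factors, the transfer of `g` is a product of powers of `g` whose
exponents add up to the index of `H`; a homomorphism to an abelian group does not see the
conjugations. -/
theorem map_transfer_id [IsMulCommutative H] {B : Type*} [CommGroup B] (f : G →* B) (g : G) :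
    f (transfer (MonoidHom.id H) g : G) = f g ^ H.index := by
  classical
  let := H.fintypeQuotientOfFiniteIndex
  rw [transfer_eq_prod_quotient_orbitRel_zpowers_quot, index_eq_sum_minimalPeriod H g,
    ← Finset.prod_pow_eq_pow_sum]
  change (f.comp H.subtype) _ = _
  rw [map_prod]
  refine Finset.prod_congr rfl fun q _ => ?_
  simp [mul_comm]

/-- The transfer computed from an arbitrary section `f` of `G → G ⧸ H`. -/
theorem transfer_eq_prod_of_section {A : Type*} [CommGroup A] (ϕ : H →* A) [Fintype (G ⧸ H)]
    {f : G ⧸ H → G} (hf : ∀ q, (f q : G ⧸ H) = q) (g : G) :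
    transfer ϕ g = ∏ q : G ⧸ H, ϕ ⟨(f q)⁻¹ * (g * f (g⁻¹ • q)), by
      rw [← QuotientGroup.eq, hf, ← smul_eq_mul, ← Quotient.smul_coe, hf, smul_inv_smul]⟩ := by
  rw [transfer_def ϕ ⟨Set.range f, isComplement_range_left hf⟩, leftTransversals.diff]
  refine Finset.prod_congr (by ext; simp) fun q _ => ?_
  congr 2
  rw [smul_apply_eq_smul_apply_inv_smul, IsComplement.leftQuotientEquiv_apply hf,
    IsComplement.leftQuotientEquiv_apply hf, smul_eq_mul]

/-- The transfer commutes with the automorphisms of `G` that stabilise `H`: such an automorphism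
carries a transversal of `H` to another one, and the transfer does not depend on the transversal. -/
theorem transfer_mulEquiv [IsMulCommutative H] (α : G ≃* G) (hα : H.map α.toMonoidHom = H)
    (g : G) : (transfer (MonoidHom.id H) (α g) : G) = α (transfer (MonoidHom.id H) g : G) := by
  classical
  let := H.fintypeQuotientOfFiniteIndex
  have hmem : ∀ x, α x ∈ H ↔ x ∈ H := by
    intro x
    conv_lhs => rw [← hα]
    simp
  let e : G ⧸ H ≃ G ⧸ H := Quotient.congr α.toEquiv fun a b => by
    simp only [QuotientGroup.leftRel_apply]
    rw [← hmem]; simp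
  have he : ∀ x : G, e (x : G ⧸ H) = ((α x : G) : G ⧸ H) := fun x => rfl
  have hes : ∀ (x : G) (q : G ⧸ H), e (x • q) = α x • e q := by
    intro x q
    induction q using QuotientGroup.induction_on with
    | H y =>
      rw [he, Quotient.smul_coe, he, Quotient.smul_coe]; simp
  -- `f` is a section and `f'` is its image under `α`.
  let f : G ⧸ H → G := Quotient.out
  have hf : ∀ q, (f q : G ⧸ H) = q := fun q => Quotient.out_eq' q
  let f' : G ⧸ H → G := fun q => α (f (e.symm q))
  have hf' : ∀ q, (f' q : G ⧸ H) = q := by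
    intro q
    rw [← he, hf, e.apply_symm_apply]
  let β : H →* H := (α.toMonoidHom.comp H.subtype).codRestrict H fun x => (hmem x).2 x.2
  have hβ : ∀ x : H, ((β x : H) : G) = α x := fun x => rfl
  rw [← hβ, transfer_eq_prod_of_section _ hf', transfer_eq_prod_of_section _ hf, map_prod]
  congr 1
  refine (e.prod_comp _).symm.trans (Finset.prod_congr rfl fun q _ => Subtype.ext ?_)
  rw [hβ]
  simp only [MonoidHom.id_apply, f', Equiv.symm_apply_apply, map_mul, map_inv]
  congr 4
  rw [Equiv.symm_apply_eq, hes, map_inv]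

end MonoidHom

/-! ### Gaschütz's theorem -/

namespace Subgroup
open scoped IsMulCommutative
variable {G : Type*} [Group G]

/-- **Gaschütz's theorem**: an abelian normal subgroup `A` has a complement in `G` as soon as it has
a complement `K` in a subgroup `A ⊔ K` whose index is prime to `|A|`. -/
theorem exists_isComplement'_of_disjoint_of_coprime [Finite G] {A K : Subgroup G} [A.Normal]
    [IsMulCommutative A] (hd : Disjoint A K) (hc : (Nat.card A).Coprime (A ⊔ K).index) :
    ∃ H : Subgroup G, IsComplement' A H := by
  classical
  -- Representatives of the double cosets `A g K` give a map `σ : G → A` with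
  -- `σ (a g x) = a σ g` for `a ∈ A` and `x ∈ K`; it is well defined as `A` meets every conjugate
  -- of `K` trivially.
  let s := DoubleCoset.setoid (A : Set G) (K : Set G)
  have hs : ∀ g, ∃ a : A, ∃ k ∈ K, g = a * (Quotient.mk s g).out * k := by
    intro g
    obtain ⟨a, ha, k, hk, h⟩ := DoubleCoset.rel_iff.1 (Quotient.mk_out (s := s) g)
    exact ⟨⟨a, ha⟩, k, hk, h⟩
  choose σ k hk hσ using hs
  have hq : ∀ (a : A) (g : G), ∀ x ∈ K, Quotient.mk s (a * g * x) = Quotient.mk s g := by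
    intro a g x hx
    refine Quotient.sound (DoubleCoset.rel_iff.2 ⟨_, inv_mem a.2, _, inv_mem hx, by group⟩)
  have hσ' : ∀ (a : A) (g : G), ∀ x ∈ K, σ (a * g * x) = a * σ g := by
    intro a g x hx
    have h1 := hσ (a * g * x)
    rw [hq a g x hx] at h1
    have h2 := hσ g
    set r := (Quotient.mk s g).out
    have h3 : (r⁻¹ * (((a * σ g : A) : G)⁻¹ * σ (a * g * x)) * r) = k g * x * (k (a * g * x))⁻¹ := by
      have : (a : G) * (σ g * r * k g) * x = σ (a * g * x) * r * k (a * g * x) := by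
        rw [← h2, ← h1]
      rw [eq_mul_inv_iff_mul_eq]
      simp only [mul_assoc] at this ⊢
      rw [← this]
      simp [mul_assoc]
    have h4 : (r⁻¹ * (((a * σ g : A) : G)⁻¹ * σ (a * g * x)) * r) ∈ A := by
      have := (inferInstance : A.Normal).conj_mem (((a * σ g : A) : G)⁻¹ * σ (a * g * x))
        (mul_mem (inv_mem (a * σ g).2) (σ _).2) r⁻¹
      simpa using this
    have h5 := disjoint_def.1 hd h4
      (h3 ▸ mul_mem (mul_mem (hk _) hx) (inv_mem (hk _)))
    have h6 : (((a * σ g : A) : G)⁻¹ * σ (a * g * x)) = 1 := by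
      have := congrArg (fun y => r * y * r⁻¹) h5
      simpa [mul_assoc] using this
    exact Subtype.ext (inv_mul_eq_one.1 h6).symm
  -- `ρ` is the conjugation action of `G` on `A`.
  let ρ : G →* MulAut A := MulAut.conjNormal
  have hρ : ∀ (g : G) (a : A), g * a = ρ g a * g := by
    intro g a; simp [ρ]
  have hρa : ∀ a b : A, ρ a b = b := by
    intro a b
    refine Subtype.ext ?_
    simp only [ρ, MulAut.conjNormal_apply]
    rw [mul_inv_eq_iff_eq_mul]
    exact congrArg Subtype.val (mul_comm a b)
  let P := A ⊔ K
  -- `b g x` measures how far `σ` is from being equivariant; as a function of `x` it is constant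
  -- on the left cosets of `P`.
  let b : G → G → A := fun g x => σ (g * x) * (ρ g (σ x))⁻¹
  have hb : ∀ g x, ∀ y ∈ P, b g (x * y) = b g x := by
    intro g x y hy
    obtain ⟨a, ha, z, hz, rfl⟩ := mem_sup_of_normal_left.1 hy
    have e1 : x * (a * z) = ρ x ⟨a, ha⟩ * x * z := by
      rw [← hρ x ⟨a, ha⟩, mul_assoc]
    have e2 : g * (x * (a * z)) = ρ g (ρ x ⟨a, ha⟩) * (g * x) * z := by
      rw [e1, ← mul_assoc, ← mul_assoc, hρ]; simp only [mul_assoc]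
    simp only [b]
    rw [e2, e1, hσ' _ _ _ hz, hσ' _ _ _ hz, map_mul, mul_inv, mul_mul_mul_comm, mul_inv_cancel,
      one_mul]
  have hb' : ∀ g (q : G ⧸ P) (x : G), (x : G ⧸ P) = q → b g q.out = b g x := by
    rintro g q x rfl
    obtain ⟨y, hy⟩ := QuotientGroup.mk_out_eq_mul P x
    rw [hy, hb _ _ _ y.2]
  have hbm : ∀ g h x, b (g * h) x = b g (h * x) * ρ g (b h x) := by
    intro g h x
    simp only [b, map_mul, MulAut.mul_apply, map_inv, mul_assoc, inv_mul_cancel_left]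
  let : Fintype (G ⧸ P) := Fintype.ofFinite _
  -- The product of `b g` over `G ⧸ P` is a cocycle whose restriction to `A` is the power map of
  -- exponent `|G : P|`, hence bijective; its kernel is the complement.
  let c : G → A := fun g => ∏ q : G ⧸ P, b g q.out
  have hcm : ∀ g h, c (g * h) = c g * ρ g (c h) := by
    intro g h
    simp only [c, hbm, Finset.prod_mul_distrib, map_prod]
    congr 1
    rw [← Equiv.prod_comp (MulAction.toPerm h) fun q : G ⧸ P => b g q.out]
    refine Finset.prod_congr rfl fun q _ => (hb' _ _ _ ?_).symm
    rw [← smul_eq_mul, ← MulAction.Quotient.smul_coe, QuotientGroup.out_eq', MulAction.toPerm_apply]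
  have hca : ∀ a : A, c a = a ^ P.index := by
    intro a
    have : ∀ x, b a x = a := by
      intro x
      simp only [b, hρa]
      have := hσ' a x 1 K.one_mem
      rw [mul_one] at this
      rw [this, mul_inv_cancel_right]
    simp [c, this, index_eq_card, Nat.card_eq_fintype_card]
  have hc1 : c 1 = 1 := by simpa using hca 1
  let H : Subgroup G :=
    { carrier := {g | c g = 1}
      one_mem' := hc1
      mul_mem' := by
        intro g h (hg : c g = 1) (hh : c h = 1)
        change c (g * h) = 1
        rw [hcm, hg, hh, map_one, mul_one]
      inv_mem' := by
        intro g (hg : c g = 1)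
        have := hcm g⁻¹ g
        rw [inv_mul_cancel, hc1, hg, map_one, mul_one] at this
        exact this.symm }
  refine ⟨H, isComplement'_of_disjoint_and_mul_eq_univ ?_ (Set.eq_univ_of_forall fun g => ?_)⟩
  · rw [disjoint_def]
    intro x hx (hx' : c x = 1)
    have h1 := hca ⟨x, hx⟩
    rw [hx'] at h1
    exact congrArg Subtype.val ((powCoprime hc).injective (a₁ := ⟨x, hx⟩) (a₂ := 1)
      (by simpa using h1.symm))
  · obtain ⟨a, ha⟩ := (powCoprime hc).surjective (c g)
    have ha' : a ^ P.index = c g := ha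
    refine ⟨a, a.2, a⁻¹ * g, ?_, by simp⟩
    change c (((a⁻¹ : A) : G) * g) = 1
    rw [hcm, hca, hρa, inv_pow, ha', inv_mul_cancel]

end Subgroup

/-! ### Sylow lifts and supplements in a group with central `p`-elements -/

namespace Subgroup
open scoped IsMulCommutative
variable {G : Type*} [Group G]

/-- A *Sylow lift*: a `p`-subgroup `K` of `G` that maps isomorphically onto a Sylow `p`-subgroup of
`G ⧸ N`. It meets `N` trivially, and `p` does not divide the index of `K ⊔ N`. -/
structure IsSylowLift (p : ℕ) (N K : Subgroup G) : Prop where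
  isPGroup : IsPGroup p K
  disjoint : Disjoint K N
  not_dvd_index : ¬ p ∣ (K ⊔ N).index

/-- A `p`-subgroup of `G` normalises some Sylow `p`-subgroup of `N`, because the number of these is
prime to `p`. -/
theorem exists_sylow_map_conjNormal_eq [Finite G] {p : ℕ} [Fact p.Prime] (N : Subgroup G)
    [N.Normal] {K : Subgroup G} (hK : IsPGroup p K) :
    ∃ Q : Sylow p N, ∀ k ∈ K,
      (Q : Subgroup N).map (MulAut.conjNormal k : MulAut N).toMonoidHom = Q := by
  let := MulAction.compHom (Sylow p N) ((MulAut.conjNormal (H := N)).comp K.subtype)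
  obtain ⟨Q, hQ⟩ := hK.nonempty_fixed_point_of_prime_not_dvd_card (Sylow p N)
    (not_dvd_card_sylow p N)
  refine ⟨Q, fun k hk => ?_⟩
  exact congrArg Sylow.toSubgroup (hQ ⟨k, hk⟩)

/-- Let `V` be the transfer from `N` to an abelian Sylow `p`-subgroup of `N` that `K` normalises. By
`V (V n) = V n ^ m`, where `m` is prime to `p`, the group `N` is the semidirect product of the kernel
`R` and the range `C` of `V`. The kernel is normal in `G`, and `K` normalises `C`.
Finally `C` is nontrivial because `V z = z ^ m` for a central `p`-element `z`. -/
theorem exists_normal_complement_of_mem_center [Finite G] {p : ℕ} [Fact p.Prime] {N : Subgroup G}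
    [N.Normal] (hab : ∀ Q ≤ N, IsPGroup p Q → IsMulCommutative Q) {K : Subgroup G}
    (hK : IsPGroup p K) {z : N} (hz : z ∈ center N) (hz1 : z ≠ 1)
    {k : ℕ} (hzp : orderOf z = p ^ k) :
    ∃ R C : Subgroup G, R.Normal ∧ C ≠ ⊥ ∧ IsPGroup p C ∧ Disjoint R C ∧ R ⊔ C = N ∧
      (∀ a ∈ N, ∀ b ∈ N, a * b * a⁻¹ * b⁻¹ ∈ R) ∧ K ≤ normalizer (C : Set G) := by
  obtain ⟨Q, hQ⟩ := exists_sylow_map_conjNormal_eq N hK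
  have : IsMulCommutative (Q : Subgroup N) := by
    have := hab _ (map_subtype_le (Q : Subgroup N)) (Q.2.map _)
    refine ⟨⟨fun a b => ?_⟩⟩
    have := setLike_mul_comm (mem_map_of_mem N.subtype a.2)
      (mem_map_of_mem N.subtype b.2)
    exact Subtype.ext (Subtype.ext this)
  let V : N →* Q := MonoidHom.transfer (MonoidHom.id (Q : Subgroup N))
  have hV : ∀ n, V (V n : N) = V n ^ (Q : Subgroup N).index := fun n =>
    MonoidHom.map_transfer_id V n
  have hVab : ∀ n, (Abelianization.of (V n : N)) = Abelianization.of n ^ (Q : Subgroup N).index :=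
    fun n => MonoidHom.map_transfer_id Abelianization.of n
  have hcop : (Nat.card Q).Coprime (Q : Subgroup N).index := Q.card_coprime_index
  have hinj : ∀ x : Q, x ^ (Q : Subgroup N).index = 1 → x = 1 := fun x hx =>
    (powCoprime hcop).injective (a₁ := x) (a₂ := 1) (by simpa using hx)
  -- The kernel of `V` consists of the elements whose class in the abelianization of `N` is killed
  -- by `m`; this description shows that it is characteristic in `N`.
  have hker : ∀ n, V n = 1 ↔ Abelianization.of n ^ (Q : Subgroup N).index = 1 := by
    intro n
    constructor
    · intro h
      rw [← hVab, h]; simp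
    · intro h
      apply hinj
      rw [← map_pow]
      rw [← map_pow] at h
      have := congrArg (Abelianization.lift V) h
      simpa using this
  let R : Subgroup G := V.ker.map N.subtype
  let C : Subgroup G := (V.range.map (Q : Subgroup N).subtype).map N.subtype
  have hCp : IsPGroup p C := ((Q.2.to_subgroup V.range).map _).map _
  have hRN : R ≤ N := map_subtype_le _
  have hCN : C ≤ N := map_subtype_le _
  refine ⟨R, C, ⟨?_⟩, ?_, hCp, ?_, le_antisymm (sup_le hRN hCN) ?_, ?_, ?_⟩
  · rintro _ ⟨n, hn, rfl⟩ g
    have hn' : V n = 1 := hn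
    refine ⟨MulAut.conjNormal g n, ?_, by simp⟩
    change V _ = 1
    rw [hker] at hn' ⊢
    have := congrArg (Abelianization.map (MulAut.conjNormal g : MulAut N).toMonoidHom) hn'
    simpa using this
  · intro hC
    have h1 : V z = 1 := by
      have : ((V z : N) : G) ∈ C := mem_map_of_mem _ (mem_map_of_mem _ ⟨z, rfl⟩)
      rw [hC, mem_bot] at this
      exact Subtype.ext (Subtype.ext this)
    have h2 := MonoidHom.transfer_eq_pow (MonoidHom.id (Q : Subgroup N)) z (fun k g₀ _ => by
      rw [mul_assoc, ← mem_center_iff.1 (pow_mem hz k) g₀, inv_mul_cancel_left])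
    have h3 : z ^ (Q : Subgroup N).index = 1 :=
      congrArg Subtype.val (h2.symm.trans h1)
    have h4 : (orderOf z).Coprime (Q : Subgroup N).index := by
      rw [hzp]
      exact Nat.Coprime.pow_left _ ((Nat.Prime.coprime_iff_not_dvd Fact.out).2 Q.not_dvd_index)
    exact hz1 (orderOf_eq_one_iff.1 (h4.eq_one_of_dvd (orderOf_dvd_of_pow_eq_one h3)))
  · rw [disjoint_def]
    rintro _ ⟨n, hn, rfl⟩ ⟨_, ⟨_, ⟨y, rfl⟩, rfl⟩, h⟩
    have h1 : (V y : N) = n := Subtype.ext h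
    have h2 : V n = 1 := hn
    rw [← h1, hV] at h2
    rw [← h1, hinj _ h2]; rfl
  · intro x hx
    obtain ⟨w, hw⟩ : ∃ w : N, V (V w) = V ⟨x, hx⟩ := by
      obtain ⟨⟨_, y, rfl⟩, hc⟩ := (powCoprime (hcop.coprime_dvd_left
        (card_subgroup_dvd_card V.range))).surjective ⟨V ⟨x, hx⟩, ⟨_, rfl⟩⟩
      exact ⟨y, (hV y).trans (congrArg Subtype.val hc)⟩
    have h1 : x * (V w : N)⁻¹ ∈ R := by
      refine ⟨⟨x, hx⟩ * (V w : N)⁻¹, ?_, rfl⟩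
      change V _ = 1
      rw [map_mul, map_inv, hw, mul_inv_cancel]
    have h2 : ((V w : N) : G) ∈ C := mem_map_of_mem _ (mem_map_of_mem _ ⟨w, rfl⟩)
    simpa using mul_mem_sup h1 h2
  · intro a ha b hb
    refine ⟨⟨a, ha⟩ * ⟨b, hb⟩ * ⟨a, ha⟩⁻¹ * ⟨b, hb⟩⁻¹, ?_, rfl⟩
    change V _ = 1
    rw [map_mul, map_mul, map_mul, map_inv, map_inv, mul_comm (V ⟨a, ha⟩), mul_inv_cancel_right,
      mul_inv_cancel]
  · have hK' : ∀ k ∈ K, ∀ x ∈ C, k * x * k⁻¹ ∈ C := by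
      rintro k hk _ ⟨_, ⟨_, ⟨y, rfl⟩, rfl⟩, rfl⟩
      have := MonoidHom.transfer_mulEquiv (H := (Q : Subgroup N)) _ (hQ k hk) y
      refine ⟨_, ⟨_, ⟨MulAut.conjNormal k y, rfl⟩, rfl⟩, ?_⟩
      exact (congrArg Subtype.val this).trans (by simp [V])
    intro k hk
    rw [mem_normalizer_iff]
    refine fun x => ⟨hK' k hk x, fun h => ?_⟩
    simpa [mul_assoc] using hK' k⁻¹ (inv_mem hk) _ h

/-- If `N` has a nontrivial central `p`-element, then `G` has a proper supplement `X` of `N` of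
`p`-power index that still contains a Sylow lift for `p`: with `R` and `C` as in
`exists_normal_complement_of_mem_center`, the image of `X` in `G ⧸ R` is a complement of the abelian
group `N / R`, so that `X` is a complement of `C` in `G`, and the new lift is the intersection of `X`
with `C ⊔ K`, a complement of `C` in `C ⊔ K`. -/
theorem exists_supplement_of_mem_center [Finite G] {p : ℕ} [Fact p.Prime] {N : Subgroup G}
    [N.Normal] (hab : ∀ Q ≤ N, IsPGroup p Q → IsMulCommutative Q) {K : Subgroup G}
    (hK : IsSylowLift p N K) {z : N} (hz : z ∈ center N) (hz1 : z ≠ 1)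
    {k : ℕ} (hzp : orderOf z = p ^ k) :
    ∃ X : Subgroup G, X ≠ ⊤ ∧ X ⊔ N = ⊤ ∧ (∃ k, X.index = p ^ k) ∧
      ∃ K' ≤ X, IsSylowLift p N K' := by
  obtain ⟨R, C, hR, hC, hCp, hRC, hN, hcomm, hKC⟩ :=
    exists_normal_complement_of_mem_center hab hK.isPGroup hz hz1 hzp
  have hRN : R ≤ N := hN ▸ le_sup_left
  have hCN : C ≤ N := hN ▸ le_sup_right
  let f := QuotientGroup.mk' R
  have hf : Function.Surjective f := QuotientGroup.mk'_surjective R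
  have hf1 : ∀ x, f x = 1 ↔ x ∈ R := fun x => QuotientGroup.eq_one_iff x
  have hA : (N.map f).Normal := Normal.map inferInstance f hf
  have hAC : N.map f = C.map f := by
    rw [← hN, map_sup, sup_eq_right]
    rintro _ ⟨x, hx, rfl⟩
    rw [(hf1 x).2 hx]; exact one_mem _
  have : IsMulCommutative (N.map f) := by
    refine ⟨⟨?_⟩⟩
    rintro ⟨_, a, ha, rfl⟩ ⟨_, b, hb, rfl⟩
    refine Subtype.ext ?_
    have := (hf1 _).2 (hcomm a ha b hb)
    simp only [map_mul, map_inv] at this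
    exact (mul_inv_eq_iff_eq_mul.1 (mul_inv_eq_one.1 this))
  have hd : Disjoint (N.map f) (K.map f) := by
    rw [disjoint_def]
    rintro _ ⟨n, hn, rfl⟩ ⟨k, hk, h⟩
    have h1 : k⁻¹ * n ∈ R := by rw [← hf1, map_mul, map_inv, h, inv_mul_cancel]
    have h2 : k ∈ N := by
      have := mul_mem hn (inv_mem (hRN h1))
      simpa using this
    rw [← h, disjoint_def.1 hK.disjoint hk h2, map_one]
  have hind : (N.map f ⊔ K.map f).index = (K ⊔ N).index := by
    rw [← map_sup, sup_comm]
    refine index_map_eq _ hf ?_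
    rw [QuotientGroup.ker_mk']
    exact hRN.trans le_sup_right
  obtain ⟨k, hk⟩ := (hCp.map f).exists_card_eq
  rw [← hAC] at hk
  obtain ⟨H, hH⟩ := exists_isComplement'_of_disjoint_of_coprime hd (by
    rw [hk, hind]
    exact Nat.Coprime.pow_left _ ((Nat.Prime.coprime_iff_not_dvd Fact.out).2 hK.not_dvd_index))
  have hXN : ∀ x, f x ∈ H → x ∈ N → x ∈ R := fun x hx hn =>
    (hf1 x).1 (disjoint_def.1 hH.disjoint (mem_map_of_mem f hn) hx)
  have hXC : ∀ g, ∃ c ∈ C, f (g * c⁻¹) ∈ H := by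
    intro g
    have h1 : f g ∈ H ⊔ N.map f := by rw [sup_comm, hH.sup_eq_top]; trivial
    obtain ⟨h, hh, _, hc, h2⟩ := mem_sup_of_normal_right.1 h1
    rw [hAC] at hc
    obtain ⟨c, hc, rfl⟩ := hc
    refine ⟨c, hc, ?_⟩
    rwa [map_mul, map_inv, ← h2, mul_inv_cancel_right]
  refine ⟨H.comap f, ?_, ?_, ⟨k, ?_⟩, H.comap f ⊓ (C ⊔ K), inf_le_left, ?_, ?_, ?_⟩
  · intro h
    apply hC
    rw [eq_bot_iff]
    intro c hc
    have hc' : c ∈ H.comap f := h ▸ mem_top c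
    exact disjoint_def.1 hRC (hXN c hc' (hCN hc)) hc
  · rw [eq_top_iff]
    intro g _
    obtain ⟨c, hc, h⟩ := hXC g
    have h' : g * c⁻¹ ∈ H.comap f := h
    simpa using mul_mem_sup h' (hCN hc)
  · rw [index_comap_of_surjective _ hf, hH.index_eq_card, hk]
  · exact (hCp.to_sup_of_normal_left' hK.isPGroup hKC).to_inf_right
  · rw [disjoint_def]
    rintro x ⟨hx, hxCK⟩ hxN
    have hx' : x ∈ ((C ⊔ K : Subgroup G) : Set G) := hxCK
    rw [coe_mul_of_right_le_normalizer_left _ _ hKC] at hx'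
    obtain ⟨c, hc, y, hy, rfl⟩ := hx'
    have hyN : y ∈ N := by simpa using mul_mem (inv_mem (hCN hc)) hxN
    have := disjoint_def.1 hK.disjoint hy hyN
    subst this
    exact disjoint_def.1 hRC (hXN _ hx hxN) (by simpa using hc)
  · intro h
    refine hK.not_dvd_index (h.trans (index_dvd_of_le (sup_le ?_ le_sup_right)))
    intro y hy
    obtain ⟨c, hc, h⟩ := hXC y
    have h' : y * c⁻¹ ∈ H.comap f ⊓ (C ⊔ K) :=
      ⟨h, (C ⊔ K).mul_mem (mem_sup_right hy) ((C ⊔ K).inv_mem (mem_sup_left hc))⟩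
    simpa using mul_mem_sup h' (hCN hc)

end Subgroup

/-! ### Sylow lifts and change of the ambient group -/

namespace Subgroup
variable {G : Type*} [Group G]

theorem relIndex_eq_index_of_sup_eq_top {N L M : Subgroup G} [N.Normal] (hL : L ⊔ N = ⊤)
    (hM : N ≤ M) : M.relIndex L = M.index := by
  let f := QuotientGroup.mk' N
  have hf : Function.Surjective f := QuotientGroup.mk'_surjective N
  have hk : f.ker ≤ M := by rwa [QuotientGroup.ker_mk']
  have hs : Function.Surjective (f.comp L.subtype) := by
    intro y
    obtain ⟨g, rfl⟩ := hf y
    obtain ⟨l, hl, n, hn, rfl⟩ := mem_sup_of_normal_right.1 (hL ▸ mem_top g : g ∈ L ⊔ N)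
    refine ⟨⟨l, hl⟩, ?_⟩
    have : f n = 1 := (QuotientGroup.eq_one_iff n).2 hn
    simp [this]
  rw [← index_map_eq M hf hk, ← index_comap_of_surjective _ hs, ← comap_comap, comap_map_eq,
    sup_eq_left.2 hk]
  rfl

theorem sup_subgroupOf_eq_of_normal {N L : Subgroup G} [N.Normal] (K : Subgroup L) :
    K ⊔ N.subgroupOf L = (K.map L.subtype ⊔ N).subgroupOf L := by
  refine le_antisymm (sup_le ?_ (comap_mono le_sup_right)) ?_
  · exact fun x hx => mem_sup_left (mem_map_of_mem _ hx)
  · intro x hx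
    obtain ⟨_, ⟨k, hk, rfl⟩, n, hn, h⟩ := mem_sup_of_normal_right.1 (mem_subgroupOf.1 hx)
    have : k⁻¹ * x ∈ N.subgroupOf L := by
      rw [mem_subgroupOf, coe_mul, ← h]; simpa using hn
    simpa using mul_mem_sup hk this

/-- Being a Sylow lift depends only on `K` and its image in `G ⧸ N`, which is unchanged if `G` is
replaced by a supplement of `N`. -/
theorem isSylowLift_subgroupOf_iff {p : ℕ} {N L : Subgroup G} [N.Normal] (hL : L ⊔ N = ⊤)
    {K : Subgroup L} :
    IsSylowLift p (N.subgroupOf L) K ↔ IsSylowLift p N (K.map L.subtype) := by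
  have h1 : IsPGroup p K ↔ IsPGroup p (K.map L.subtype) :=
    ⟨fun h => h.map _, fun h => h.of_equiv (K.equivMapOfInjective _ L.subtype_injective).symm⟩
  have h2 : Disjoint K (N.subgroupOf L) ↔ Disjoint (K.map L.subtype) N := by
    simp only [disjoint_def]
    constructor
    · rintro h _ ⟨k, hk, rfl⟩ hn
      rw [h hk hn]; rfl
    · intro h x hx hn
      exact Subtype.ext (h (mem_map_of_mem _ hx) hn)
  have h3 : (K ⊔ N.subgroupOf L).index = (K.map L.subtype ⊔ N).index := by
    rw [sup_subgroupOf_eq_of_normal, ← relIndex_eq_index_of_sup_eq_top hL le_sup_right]; rfl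
  exact ⟨fun h => ⟨h1.1 h.1, h2.1 h.2, h3 ▸ h.3⟩, fun h => ⟨h1.2 h.1, h2.2 h.2, h3 ▸ h.3⟩⟩

theorem IsSylowLift.map_conj {p : ℕ} {N K : Subgroup G} [N.Normal] (hK : IsSylowLift p N K)
    (g : G) : IsSylowLift p N (K.map (MulAut.conj g).toMonoidHom) := by
  have hN : N.map (MulAut.conj g).toMonoidHom = N := by
    refine le_antisymm ?_ fun x hx => ?_
    · rintro _ ⟨n, hn, rfl⟩
      exact ‹N.Normal›.conj_mem n hn g
    · refine ⟨g⁻¹ * x * g, ?_, by simp [mul_assoc]⟩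
      simpa using ‹N.Normal›.conj_mem x hx g⁻¹
  refine ⟨hK.isPGroup.map _, ?_, ?_⟩
  · rw [disjoint_iff]
    conv_lhs => rw [← hN]
    rw [← map_inf_eq _ _ _ (MulAut.conj g).injective, hK.disjoint.eq_bot, map_bot]
  · conv =>
      enter [1, 2, 1]
      rw [← hN]
    rw [← map_sup]
    have := index_map_equiv (K ⊔ N) (MulAut.conj g)
    exact fun h => hK.not_dvd_index (this ▸ h)

/-- A `p`-group acting on a set of cosets whose cardinality is prime to `p` has a fixed point. -/
theorem exists_map_conj_le_of_not_dvd_relIndex [Finite G] {p : ℕ} [Fact p.Prime]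
    {K M L : Subgroup G} (hK : IsPGroup p K) (hKL : K ≤ L) (hM : ¬ p ∣ M.relIndex L) :
    ∃ g ∈ L, K.map (MulAut.conj g).toMonoidHom ≤ M := by
  let := MulAction.compHom (L ⧸ M.subgroupOf L) (inclusion hKL)
  obtain ⟨q, hq⟩ := hK.nonempty_fixed_point_of_prime_not_dvd_card (L ⧸ M.subgroupOf L) hM
  induction q using QuotientGroup.induction_on with
  | H l =>
    refine ⟨_, inv_mem l.2, ?_⟩
    rintro _ ⟨k, hk, rfl⟩
    have h : ((l : L) : L ⧸ M.subgroupOf L) = ((inclusion hKL ⟨k, hk⟩ * l : L)) :=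
      (hq ⟨k, hk⟩).symm
    rw [QuotientGroup.eq, mem_subgroupOf] at h
    simpa [mul_assoc] using h

theorem exists_isSylowLift_of_not_dvd_card_inf [Finite G] {p : ℕ} [Fact p.Prime]
    {N H : Subgroup G} [N.Normal] (hH : H ⊔ N = ⊤) (hp : ¬ p ∣ Nat.card (H ⊓ N : Subgroup G)) :
    ∃ K ≤ H, IsSylowLift p N K := by
  let Q : Sylow p H := default
  refine ⟨(Q : Subgroup H).map H.subtype, map_subtype_le _,
    (isSylowLift_subgroupOf_iff hH).1 ⟨Q.2, ?_, fun h => Q.not_dvd_index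
      (h.trans (index_dvd_of_le le_sup_left))⟩⟩
  rw [disjoint_iff]
  refine card_eq_one.1 ((Q.2.to_inf_left (K := N.subgroupOf H)).card_eq_or_dvd.resolve_right
    fun h => hp (h.trans ((card_dvd_of_le inf_le_right).trans (dvd_of_eq ?_))))
  rw [← inf_subgroupOf_left, Nat.card_congr (subgroupOfEquivOfLe inf_le_left).toEquiv]

/-- The relative form of `exists_supplement_of_mem_center`, inside a supplement `L` of `N`. -/
theorem exists_lt_supplement_of_central [Finite G] {p : ℕ} [Fact p.Prime] {N L : Subgroup G}
    [N.Normal] (hab : ∀ Q ≤ N, IsPGroup p Q → IsMulCommutative Q) (hL : L ⊔ N = ⊤)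
    {K : Subgroup G} (hKL : K ≤ L) (hK : IsSylowLift p N K) {z : G} (hzL : z ∈ L) (hzN : z ∈ N)
    (hzc : ∀ x ∈ L, x ∈ N → x * z = z * x) (hz1 : z ≠ 1) {k : ℕ} (hzp : orderOf z = p ^ k) :
    ∃ X < L, X ⊔ N = ⊤ ∧ (∃ k, X.relIndex L = p ^ k) ∧ ∃ K' ≤ X, IsSylowLift p N K' := by
  have hab' : ∀ Q ≤ N.subgroupOf L, IsPGroup p Q → IsMulCommutative Q := by
    intro Q hQ hQp
    have := hab (Q.map L.subtype) (map_le_iff_le_comap.2 hQ) (hQp.map _)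
    refine ⟨⟨fun a b => Subtype.ext (Subtype.ext ?_)⟩⟩
    exact setLike_mul_comm (mem_map_of_mem L.subtype a.2) (mem_map_of_mem L.subtype b.2)
  have hKm : (K.subgroupOf L).map L.subtype = K := map_subgroupOf_eq_of_le hKL
  have hK' := (isSylowLift_subgroupOf_iff hL (K := K.subgroupOf L)).2 (hKm.symm ▸ hK)
  let z' : N.subgroupOf L := ⟨⟨z, hzL⟩, hzN⟩
  obtain ⟨X, hX, hXN, ⟨k, hk⟩, K₁, hK₁, hl⟩ := exists_supplement_of_mem_center hab' hK' (z := z')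
    (mem_center_iff.2 fun x => Subtype.ext (Subtype.ext (hzc x x.1.2 x.2)))
    (fun h => hz1 (congrArg (fun y : N.subgroupOf L => ((y : L) : G)) h))
    (k := k) (by rw [← hzp, ← orderOf_coe z', ← orderOf_coe (z' : L)])
  refine ⟨X.map L.subtype, lt_of_le_of_ne (map_subtype_le _) fun h => hX ?_, ?_, ⟨k, ?_⟩,
    K₁.map L.subtype, map_mono hK₁, (isSylowLift_subgroupOf_iff hL).1 hl⟩
  · exact map_injective L.subtype_injective
      (h.trans (by rw [← MonoidHom.range_eq_map, range_subtype]))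
  · rw [eq_top_iff, ← hL]
    refine sup_le ?_ le_sup_right
    have := congrArg (map L.subtype) hXN
    rw [map_sup, subgroupOf_map_subtype, ← MonoidHom.range_eq_map, range_subtype] at this
    calc L = _ := this.symm
      _ ≤ _ := sup_le_sup_left inf_le_left _
  · rw [relIndex, subgroupOf, comap_map_eq_self_of_injective L.subtype_injective, hk]

theorem centralizer_sylow_eq_top_of_isNilpotent {D : Type*} [Group D] [Finite D]
    [Group.IsNilpotent D] {p : ℕ} [Fact p.Prime] (P : Sylow p D)
    [IsMulCommutative (P : Subgroup D)] : centralizer (P : Set D) = ⊤ := by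
  rw [← index_eq_one, Nat.eq_one_iff_not_exists_prime_dvd]
  intro q hq h
  have := Fact.mk hq
  let Q : Sylow q D := default
  refine Q.not_dvd_index
    (h.trans (index_dvd_of_le fun x hx => mem_centralizer_iff.2 fun y hy => ?_))
  by_cases hpq : p = q
  · subst hpq
    have : Unique (Sylow p D) := P.unique_of_normal inferInstance
    have hQP : Q = P := Subsingleton.elim _ _
    rw [hQP] at hx
    exact setLike_mul_comm (s := (P : Subgroup D)) hy hx
  · exact commute_of_normal_of_disjoint _ _ inferInstance inferInstance
      (IsPGroup.disjoint_of_ne p q hpq _ _ P.2 Q.2) y x hy hx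

end Subgroup

/-! ### Minimal supplements -/

namespace Subgroup
variable {G : Type*} [Group G]

theorem exists_minimal_supplement [Finite G] {N H : Subgroup G} (hH : H ⊔ N = ⊤) :
    ∃ M ≤ H, M ⊔ N = ⊤ ∧ ∀ X < M, X ⊔ N ≠ ⊤ := by
  obtain ⟨M, hMH, hM⟩ := exists_minimal_le_of_wellFoundedLT (fun X : Subgroup G => X ⊔ N = ⊤) H hH
  exact ⟨M, hMH, hM.1, fun X hX h => hX.not_ge (hM.2 h hX.le)⟩

/-- The Frattini argument: the normaliser in `H` of a Sylow subgroup of `H ⊓ N` is again a supplement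
of `N`. -/
theorem normal_map_sylow_of_minimal_supplement [Finite G] {N H : Subgroup G} [N.Normal]
    (hH : H ⊔ N = ⊤) (hmin : ∀ X < H, X ⊔ N ≠ ⊤) {p : ℕ} [Fact p.Prime]
    (P : Sylow p (N.subgroupOf H)) :
    ((P : Subgroup (N.subgroupOf H)).map (N.subgroupOf H).subtype).Normal := by
  have h := Sylow.normalizer_sup_eq_top P
  rw [← normalizer_eq_top_iff]
  by_contra hne
  refine hmin ((normalizer (((P : Subgroup (N.subgroupOf H)).map
    (N.subgroupOf H).subtype : Subgroup H) : Set H)).map H.subtype)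
    (lt_of_le_of_ne (map_subtype_le _) fun h' => hne ?_) ?_
  · exact map_injective H.subtype_injective
      (h'.trans (by rw [← MonoidHom.range_eq_map, range_subtype]))
  · rw [eq_top_iff, ← hH]
    refine sup_le ?_ le_sup_right
    have h2 := congrArg (map H.subtype) h
    rw [map_sup, subgroupOf_map_subtype, ← MonoidHom.range_eq_map, range_subtype] at h2
    calc H = _ := h2.symm
      _ ≤ _ := sup_le_sup_left inf_le_left _

/-- If `H` is a minimal supplement, `H ⊓ N` is nilpotent; `T` is its Sylow `p`-subgroup, which is
abelian and hence central in `H ⊓ N`. -/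
theorem exists_pSubgroup_of_minimal_supplement [Finite G] {N H : Subgroup G} [N.Normal]
    (hH : H ⊔ N = ⊤) (hmin : ∀ X < H, X ⊔ N ≠ ⊤) {p : ℕ} [Fact p.Prime]
    (hab : ∀ Q ≤ N, IsPGroup p Q → IsMulCommutative Q)
    (hp : p ∣ Nat.card (H ⊓ N : Subgroup G)) :
    ∃ T : Subgroup G, T ≠ ⊥ ∧ T ≤ H ⊓ N ∧ IsPGroup p T ∧ H ≤ normalizer (T : Set G) ∧
      H ⊓ N ≤ centralizer (T : Set G) := by
  let D := N.subgroupOf H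
  have hnil : Group.IsNilpotent D := by
    have := (Group.isNilpotent_of_finite_tfae (G := D)).out 0 3
    refine this.2 fun q hq Q => ?_
    exact (normal_map_sylow_of_minimal_supplement hH hmin Q).of_map_subtype
  let P : Sylow p D := default
  let T' := (P : Subgroup D).map D.subtype
  have hT' : T'.Normal := normal_map_sylow_of_minimal_supplement hH hmin P
  let T := T'.map H.subtype
  have hTN : T ≤ H ⊓ N := by
    rintro _ ⟨_, ⟨y, hy, rfl⟩, rfl⟩
    exact ⟨y.1.2, y.2⟩
  have hTp : IsPGroup p T := (P.2.map _).map _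
  have hTab := hab T (hTN.trans inf_le_right) hTp
  have : IsMulCommutative (P : Subgroup D) := ⟨⟨fun a b => by
    have := setLike_mul_comm (mem_map_of_mem H.subtype (mem_map_of_mem D.subtype a.2) : _ ∈ T)
      (mem_map_of_mem H.subtype (mem_map_of_mem D.subtype b.2) : _ ∈ T)
    exact Subtype.ext (Subtype.ext (Subtype.ext this))⟩⟩
  refine ⟨T, ?_, hTN, hTp, ?_, ?_⟩
  · intro h
    have h1 : (P : Subgroup D) = ⊥ := by
      rw [← map_eq_bot_iff_of_injective _ D.subtype_injective,
        ← map_eq_bot_iff_of_injective _ H.subtype_injective]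
      exact h
    refine P.ne_bot_of_dvd_card ?_ h1
    change p ∣ Nat.card (N.subgroupOf H)
    rwa [← inf_subgroupOf_left, Nat.card_congr (subgroupOfEquivOfLe inf_le_left).toEquiv]
  · have h1 : ∀ h ∈ H, ∀ x ∈ T, h * x * h⁻¹ ∈ T := by
      rintro h hh _ ⟨x, hx, rfl⟩
      exact ⟨⟨h, hh⟩ * x * ⟨h, hh⟩⁻¹, hT'.conj_mem x hx _, rfl⟩
    intro h hh
    rw [mem_normalizer_iff]
    refine fun x => ⟨h1 h hh x, fun hx => ?_⟩
    simpa [mul_assoc] using h1 h⁻¹ (inv_mem hh) _ hx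
  · rintro x ⟨hxH, hxN⟩
    rw [mem_centralizer_iff]
    rintro _ ⟨_, ⟨y, hy, rfl⟩, rfl⟩
    have hx : (⟨⟨x, hxH⟩, hxN⟩ : D) ∈ centralizer (P : Set D) := by
      rw [centralizer_sylow_eq_top_of_isNilpotent]; trivial
    exact congrArg (fun z : D => ((z : H) : G)) (mem_centralizer_iff.1 hx y hy)

theorem relIndex_eq_relIndex_inf_of_sup_eq_top [Finite G] {N M L : Subgroup G} [N.Normal]
    (hML : M ≤ L) (hM : M ⊔ N = ⊤) : M.relIndex L = (M ⊓ N).relIndex (L ⊓ N) := by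
  have hL : L ⊔ N = ⊤ := top_le_iff.1 (hM ▸ sup_le_sup_right hML N)
  have h1 : (M ⊓ N).relIndex M = N.index := by
    rw [inf_relIndex_left, relIndex_eq_index_of_sup_eq_top hM le_rfl]
  have h2 : (L ⊓ N).relIndex L = N.index := by
    rw [inf_relIndex_left, relIndex_eq_index_of_sup_eq_top hL le_rfl]
  have h3 := relIndex_mul_relIndex (M ⊓ N) M L inf_le_left hML
  have h4 := relIndex_mul_relIndex (M ⊓ N) (L ⊓ N) L (inf_le_inf_right N hML) inf_le_left
  rw [← h4, h1, h2, mul_comm] at h3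
  exact Nat.eq_of_mul_eq_mul_right (Nat.pos_of_ne_zero index_ne_zero_of_finite) h3

/-- The reduction step. With `T` the Sylow `p`-subgroup of `H ⊓ N`, the group `M = H · C_{L ⊓ N}(T)`
contains a Sylow `p`-subgroup of `L ⊓ N`, since these are abelian; so it contains a Sylow lift for
`p`. Moreover `M ⊓ N` centralises `T`, so that `exists_lt_supplement_of_central` applies to `M`.
As `X` has `p`-power index in `M`, which contains `H`, Sylow lifts in `H` for other primes have
conjugates in `X`. -/
theorem exists_lt_supplement_of_dvd_card [Finite G] {N L H : Subgroup G} [N.Normal] {p : ℕ}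
    [Fact p.Prime] (hab : ∀ Q ≤ N, IsPGroup p Q → IsMulCommutative Q) {K : Subgroup G}
    (hKL : K ≤ L) (hK : IsSylowLift p N K) (hHL : H ≤ L) (hH : H ⊔ N = ⊤)
    (hmin : ∀ X < H, X ⊔ N ≠ ⊤) (hp : p ∣ Nat.card (H ⊓ N : Subgroup G)) :
    ∃ X M : Subgroup G, H ≤ M ∧ X < M ∧ M ≤ L ∧ X ⊔ N = ⊤ ∧ (∃ k, X.relIndex M = p ^ k) ∧
      ∃ K' ≤ X, IsSylowLift p N K' := by
  obtain ⟨T, hT, hTHN, hTp, hHT, hc⟩ := exists_pSubgroup_of_minimal_supplement hH hmin hab hp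
  let C : Subgroup G := centralizer (T : Set G) ⊓ (L ⊓ N)
  have hDC : H ⊓ N ≤ C := le_inf hc (inf_le_inf_right N hHL)
  have hHC : H ≤ normalizer (C : Set G) := by
    have h1 : ∀ h ∈ H, ∀ x ∈ C, h * x * h⁻¹ ∈ C := by
      rintro h hh x ⟨hx, hxL, hxN⟩
      refine ⟨mem_centralizer_iff.2 fun t ht => ?_,
        L.mul_mem (L.mul_mem (hHL hh) hxL) (L.inv_mem (hHL hh)), ‹N.Normal›.conj_mem x hxN h⟩
      have ht' : h⁻¹ * t * h ∈ T := by
        simpa using (mem_normalizer_iff.1 (hHT (inv_mem hh)) t).1 ht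
      have h2 := mem_centralizer_iff.1 hx _ ht'
      have h3 := congrArg (fun y => h * y * h⁻¹) h2
      simpa [mul_assoc] using h3
    intro h hh
    rw [mem_normalizer_iff]
    refine fun x => ⟨h1 h hh x, fun hx => ?_⟩
    simpa [mul_assoc] using h1 h⁻¹ (inv_mem hh) _ hx
  let M := H ⊔ C
  have hML : M ≤ L := sup_le hHL (inf_le_right.trans inf_le_left)
  have hM : M ⊔ N = ⊤ := top_le_iff.1 (hH ▸ sup_le_sup_right le_sup_left N)
  have hMN : M ⊓ N = C := by
    refine le_antisymm ?_ (le_inf le_sup_right (inf_le_right.trans inf_le_right))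
    rintro x ⟨hx, hxN⟩
    have hx' : x ∈ ((H ⊔ C : Subgroup G) : Set G) := hx
    rw [coe_mul_of_left_le_normalizer_right _ _ hHC] at hx'
    obtain ⟨h, hh, c, hc', rfl⟩ := hx'
    have hhN : h ∈ N := by simpa using N.mul_mem hxN (N.inv_mem hc'.2.2)
    exact mul_mem (hDC ⟨hh, hhN⟩) hc'
  -- A Sylow `p`-subgroup of `L ⊓ N` above `T` is abelian, hence lies in `C`.
  have hMp : ¬ p ∣ M.relIndex L := by
    rw [relIndex_eq_relIndex_inf_of_sup_eq_top hML hM, hMN]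
    have hT' : IsPGroup p (T.subgroupOf (L ⊓ N)) := hTp.comap_subtype
    obtain ⟨S, hS⟩ := hT'.exists_le_sylow
    refine fun h => S.not_dvd_index (h.trans (index_dvd_of_le fun x hx => ?_))
    have hSab := hab ((S : Subgroup (L ⊓ N : Subgroup G)).map (L ⊓ N).subtype)
      ((map_subtype_le _).trans inf_le_right) (S.2.map _)
    refine ⟨mem_centralizer_iff.2 fun t ht => ?_, x.2⟩
    have htS : t ∈ (S : Subgroup (L ⊓ N : Subgroup G)).map (L ⊓ N).subtype :=
      ⟨⟨t, (hTHN.trans (inf_le_inf_right N hHL)) ht⟩, hS ht, rfl⟩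
    exact setLike_mul_comm htS (mem_map_of_mem (L ⊓ N).subtype hx)
  obtain ⟨g, -, hg⟩ := exists_map_conj_le_of_not_dvd_relIndex hK.isPGroup hKL hMp
  obtain ⟨z, hz, hz1⟩ := (T.ne_bot_iff_exists_ne_one.1 hT).elim fun z hz =>
    (⟨z, z.2, fun h => hz (Subtype.ext h)⟩ : ∃ z : G, z ∈ T ∧ z ≠ 1)
  obtain ⟨k, hk⟩ := IsPGroup.iff_orderOf.1 hTp ⟨z, hz⟩
  rw [orderOf_mk] at hk
  obtain ⟨X, hXM, hXN, hX, hK'⟩ := exists_lt_supplement_of_central hab hM hg (hK.map_conj g)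
    (le_sup_left (b := C) (hTHN hz).1) (hTHN hz).2
    (fun x hxM hxN => (mem_centralizer_iff.1 (hMN ▸ ⟨hxM, hxN⟩ : x ∈ C).1 z hz).symm) hz1 hk
  exact ⟨X, M, le_sup_left, hXM, hML, hXN, hX, hK'⟩

/-- If for every `p ∈ s` the `p`-subgroups of `N` are abelian and the supplement `L` of `N` contains a
Sylow lift for `p`, then `L` contains a supplement `H` of `N` such that `|H ⊓ N|` is prime to every
`p ∈ s`. The outer induction is on `L`, the inner one on `s`. -/
theorem exists_supplement_of_isSylowLift [Finite G] {N : Subgroup G} [N.Normal] (s : Finset ℕ)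
    (hs : ∀ p ∈ s, p.Prime) (hab : ∀ p ∈ s, ∀ Q ≤ N, IsPGroup p Q → IsMulCommutative Q)
    (L : Subgroup G) (hL : L ⊔ N = ⊤) (hlift : ∀ p ∈ s, ∃ K ≤ L, IsSylowLift p N K) :
    ∃ H ≤ L, H ⊔ N = ⊤ ∧ ∀ p ∈ s, ¬ p ∣ Nat.card (H ⊓ N : Subgroup G) := by
  induction L using WellFoundedLT.induction generalizing s with
  | ind L ihL =>
  induction s using Finset.induction_on with
  | empty => exact ⟨L, le_rfl, hL, by simp⟩
  | insert p s hps ihs =>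
    obtain ⟨H₀, hH₀L, hH₀, hH₀s⟩ := ihs (fun q hq => hs q (Finset.mem_insert_of_mem hq))
      (fun q hq => hab q (Finset.mem_insert_of_mem hq))
      (fun q hq => hlift q (Finset.mem_insert_of_mem hq))
    obtain ⟨H, hHH₀, hH, hmin⟩ := exists_minimal_supplement hH₀
    have hHL := hHH₀.trans hH₀L
    have hHs : ∀ q ∈ s, ¬ q ∣ Nat.card (H ⊓ N : Subgroup G) := fun q hq h =>
      hH₀s q hq (h.trans (card_dvd_of_le (inf_le_inf_right N hHH₀)))
    have hpm := Finset.mem_insert_self p s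
    have := Fact.mk (hs p hpm)
    by_cases hp : p ∣ Nat.card (H ⊓ N : Subgroup G)
    · obtain ⟨K, hKL, hK⟩ := hlift p hpm
      obtain ⟨X, M, hHM, hXM, hML, hX, ⟨k, hk⟩, hK'⟩ :=
        exists_lt_supplement_of_dvd_card (hab p hpm) hKL hK hHL hH hmin hp
      obtain ⟨Y, hYX, hY⟩ := ihL X (hXM.trans_le hML) (insert p s) hs hab hX (by
        intro q hq
        obtain rfl | hqs := Finset.mem_insert.1 hq
        · exact hK'
        have := Fact.mk (hs q hq)
        obtain ⟨K₁, hK₁, hl⟩ := exists_isSylowLift_of_not_dvd_card_inf hH (hHs q hqs)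
        obtain ⟨g, -, hg⟩ := exists_map_conj_le_of_not_dvd_relIndex (M := X) hl.isPGroup
          (hK₁.trans hHM) (by
            rw [hk]
            intro h
            have := (Nat.prime_dvd_prime_iff_eq (hs q hq) (hs p hpm)).1
              ((hs q hq).dvd_of_dvd_pow h)
            exact hps (this ▸ hqs))
        exact ⟨_, hg, hl.map_conj g⟩)
      exact ⟨Y, hYX.trans (hXM.le.trans hML), hY⟩
    · refine ⟨H, hHL, hH, fun q hq => ?_⟩
      obtain rfl | hqs := Finset.mem_insert.1 hq
      exacts [hp, hHs q hqs]

end Subgroup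

/-! ### Complements in Sylow subgroups, and Šemetkov's theorem -/

namespace Subgroup
variable {G : Type*} [Group G]

theorem exists_isSylowLift_of_hasComplementIn [Finite G] {p : ℕ} [Fact p.Prime] {N : Subgroup G}
    (S : Sylow p G) (h : HasComplementIn ((S : Subgroup G) ⊓ N) (S : Subgroup G)) :
    ∃ K : Subgroup G, IsSylowLift p N K := by
  obtain ⟨-, K, hK⟩ := h
  refine ⟨K.map (S : Subgroup G).subtype, (S.2.to_subgroup K).map _, ?_, fun h => ?_⟩
  · rw [disjoint_def]
    rintro _ ⟨k, hk, rfl⟩ hN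
    rw [disjoint_def.1 hK.disjoint (x := k) ⟨k.2, hN⟩ hk]; rfl
  · refine S.not_dvd_index (h.trans (index_dvd_of_le ?_))
    have h1 := congrArg (map (S : Subgroup G).subtype) hK.sup_eq_top
    rw [map_sup, subgroupOf_map_subtype, ← MonoidHom.range_eq_map, range_subtype] at h1
    refine h1.ge.trans ?_
    exact sup_le ((inf_le_left.trans inf_le_right).trans le_sup_right) le_sup_left

theorem isMulCommutative_of_sylow_inf [Finite G] {p : ℕ} [Fact p.Prime] {N : Subgroup G}
    [N.Normal] (S : Sylow p G) [IsMulCommutative ((S : Subgroup G) ⊓ N : Subgroup G)]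
    {Q : Subgroup G} (hQN : Q ≤ N) (hQ : IsPGroup p Q) : IsMulCommutative Q := by
  obtain ⟨g, -, hg⟩ := exists_map_conj_le_of_not_dvd_relIndex (M := (S : Subgroup G)) (L := ⊤) hQ
    le_top (by rw [relIndex_top_right]; exact S.not_dvd_index)
  have h : ∀ x ∈ Q, MulAut.conj g x ∈ (S : Subgroup G) ⊓ N := fun x hx =>
    ⟨hg (mem_map_of_mem (MulAut.conj g).toMonoidHom hx), ‹N.Normal›.conj_mem x (hQN hx) g⟩
  refine ⟨⟨fun a b => Subtype.ext ((MulAut.conj g).injective ?_)⟩⟩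
  rw [coe_mul, coe_mul, map_mul, map_mul]
  exact setLike_mul_comm (h a a.2) (h b b.2)

theorem map_sylow_eq_inf [Finite G] {p : ℕ} {N : Subgroup G} (P : Sylow p N)
    (S : Sylow p G) (h : (P : Subgroup N).map N.subtype ≤ S) :
    (P : Subgroup N).map N.subtype = (S : Subgroup G) ⊓ N := by
  have h1 := P.3 (S.2.comap_subtype (K := N)) (map_le_iff_le_comap.1 h)
  rw [← h1]
  exact subgroupOf_map_subtype _ _

/-- By the Schur–Zassenhaus theorem, `H ⊓ N` has a complement in `H`. -/
theorem exists_isComplement'_of_coprime_supplement [Finite G] {N H : Subgroup G} [N.Normal]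
    (hH : H ⊔ N = ⊤) (hc : (Nat.card (H ⊓ N : Subgroup G)).Coprime N.index) :
    ∃ K : Subgroup G, IsComplement' N K := by
  have hi : (N.subgroupOf H).index = N.index := relIndex_eq_index_of_sup_eq_top hH le_rfl
  have hcard : Nat.card (N.subgroupOf H) = Nat.card (H ⊓ N : Subgroup G) := by
    rw [← inf_subgroupOf_left, Nat.card_congr (subgroupOfEquivOfLe inf_le_left).toEquiv]
  obtain ⟨K, hK⟩ := exists_right_complement'_of_coprime (N := N.subgroupOf H)
    (by rwa [hcard, hi])
  refine ⟨K.map H.subtype, isComplement'_of_disjoint_and_mul_eq_univ ?_ ?_⟩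
  · rw [disjoint_def]
    rintro _ hN ⟨k, hk, rfl⟩
    rw [disjoint_def.1 hK.disjoint (x := k) hN hk]; rfl
  · rw [← normal_mul, ← coe_top, SetLike.coe_set_eq, ← top_le_iff, ← hH]
    refine sup_le ?_ le_sup_left
    have h1 := congrArg (map H.subtype) hK.sup_eq_top
    rw [map_sup, subgroupOf_map_subtype, ← MonoidHom.range_eq_map, range_subtype] at h1
    calc H = _ := h1.symm
      _ ≤ _ := sup_le_sup_right inf_le_left _

end Subgroup

theorem mainTheorem2 {G : Type*} [Group G] [Finite G] (N : Subgroup G) [N.Normal] :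
    (∀ π : Set ℕ,
      (∀ p ∈ π, p.Prime ∧ ∃ P : Sylow p G,
        IsMulCommutative ((P : Subgroup G) ⊓ N : Subgroup G) ∧
          HasComplementIn ((P : Subgroup G) ⊓ N) (P : Subgroup G)) →
      ∃ H : Subgroup G, (H : Set G) * (N : Set G) = Set.univ ∧
        ∀ p ∈ π, ¬ p ∣ Nat.card (H ⊓ N : Subgroup G)) ∧
    ((∀ p : ℕ, p.Prime → p ∣ N.index →
      ∃ P : Sylow p N, IsMulCommutative (P : Subgroup N) ∧
        ∃ S : Sylow p G,
          HasComplementIn ((P : Subgroup N).map N.subtype) (S : Subgroup G)) →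
      ∃ K : Subgroup G, Subgroup.IsComplement' N K) := by
  have key : ∀ π : Set ℕ,
      (∀ p ∈ π, p.Prime ∧ ∃ P : Sylow p G,
        IsMulCommutative ((P : Subgroup G) ⊓ N : Subgroup G) ∧
          HasComplementIn ((P : Subgroup G) ⊓ N) (P : Subgroup G)) →
      ∃ H : Subgroup G, H ⊔ N = ⊤ ∧ ∀ p ∈ π, ¬ p ∣ Nat.card (H ⊓ N : Subgroup G) := by
    classical
    intro π hπ
    -- Only the finitely many primes dividing `|G|` matter.
    let s := {p ∈ (Nat.card G).primeFactors | p ∈ π}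
    have hsπ : ∀ p ∈ s, p ∈ π := fun p hp => (Finset.mem_filter.1 hp).2
    obtain ⟨H, -, hH, hHs⟩ := Subgroup.exists_supplement_of_isSylowLift (N := N) s
      (fun p hp => (hπ p (hsπ p hp)).1)
      (fun p hp Q hQN hQ => by
        obtain ⟨hpp, S, hS, -⟩ := hπ p (hsπ p hp)
        have := Fact.mk hpp
        exact Subgroup.isMulCommutative_of_sylow_inf S hQN hQ)
      ⊤ (top_sup_eq N) (fun p hp => by
        obtain ⟨hpp, S, -, hS⟩ := hπ p (hsπ p hp)
        have := Fact.mk hpp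
        obtain ⟨K, hK⟩ := Subgroup.exists_isSylowLift_of_hasComplementIn S hS
        exact ⟨K, le_top, hK⟩)
    refine ⟨H, hH, fun p hp h => hHs p (Finset.mem_filter.2 ⟨?_, hp⟩) h⟩
    exact Nat.mem_primeFactors.2
      ⟨(hπ p hp).1, h.trans (Subgroup.card_subgroup_dvd_card _), Nat.card_pos.ne'⟩
  refine ⟨fun π hπ => ?_, fun h => ?_⟩
  · obtain ⟨H, hH, hHπ⟩ := key π hπ
    exact ⟨H, by rw [← Subgroup.mul_normal, hH, Subgroup.coe_top], hHπ⟩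
  · obtain ⟨H, hH, hHπ⟩ := key {p | p.Prime ∧ p ∣ N.index} (fun p hp => by
      obtain ⟨P, hP, S, hS⟩ := h p hp.1 hp.2
      have hPS := Subgroup.map_sylow_eq_inf P S hS.1
      exact ⟨hp.1, S, hPS ▸ inferInstance, hPS ▸ hS⟩)
    refine Subgroup.exists_isComplement'_of_coprime_supplement hH ?_
    exact Nat.coprime_of_dvd fun p hp h1 h2 => hHπ p ⟨hp, h2⟩ h1
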